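/- Let $G=(V,E,w_G)$ be a finite undirected graph with $n$ vertices and positive edge weights. Its Laplacian $\mathcal L_G$ is the $V\times V$ matrix with off-diagonal entries $-w_G(u,v)$ and diagonal entries $\sum_{v}w_G(u,v)$ (with $w_G(u,v)=0$ for non-edges). A graph $H$ on $V$ whose edges are edges of $G$, with its own positive weights $w_H$, is a $(1\pm\epsilon)$-spectral sparsifier of $G$ if $(1-\epsilon)\,x^\top\mathcal L_H x\le x^\top\mathcal L_G x\le(1+\epsilon)\,x^\top\mathcal L_H x$ for all $x\in\mathbb R^V$. Let $d_G(u,v)$ be the shortest-path distance in $G$ where an edge $e$ has length $1/w_G(e)$ (infinite if $u,v$ are not connected). An $\alpha$-spanner of $G$ is a subgraph $T$ of $G$, with the weights of $G$, such that $d_T(u,v)\le\alpha\, d_G(u,v)$ for all $u,v\in V$. A $t$-bundle $\alpha$-spanner of $G$ is a union $B=\bigcup_{i=1}^t T_i$ of graphs such that each $T_i$ is an $\alpha$-spanner of $G\setminus\bigcup_{j<i}T_j$ (the graph $G$ with the edges of $T_1,\dots,T_{i-1}$ removed). Let $c\ge 1$, $\alpha\ge 1$ and $0<\epsilon\le 1$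 be real numbers. On input $G$, the algorithm Light-Spectral-Sparsify sets $t=\lceil 12(c+1)\alpha\epsilon^{-2}\ln n\rceil$, picks a $t$-bundle $\alpha$-spanner $B$ of $G$, and returns the graph $H$ that consists of all edges of $B$ with their weights in $G$ and, independently for each edge $e$ of $G\setminus B$ with probability $1/4$, the edge $e$ with weight $4w_G(e)$. Suppose that the (possibly random) input graph $G$ on the fixed vertex set $V$ and the (possibly random) bundle $B$ that is picked for it are jointly independent of the coin flips that decide which edges of $G\setminus B$ are kept. Then $H$ is a $(1\pm\epsilon)$-spectral sparsifier of $G$ with probability at least $1-n^{-(c+1)}$. -/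

import Mathlib

open MeasureTheory ProbabilityTheory

/-- A finite undirected graph on the vertex set `V` with non-negative edge weights and no loops,
given by its weight function on unordered pairs. The pairs of positive weight are the edges; a pair
of weight `0` is not an edge. -/
@[ext]
structure WeightedGraph (V : Type*) where
  weight : Sym2 V → ℝ
  weight_nonneg : ∀ e, 0 ≤ weight e
  weight_diag : ∀ v, weight s(v, v) = 0

namespace WeightedGraph

variable {V : Type*}

/-- The set of edges. -/
def edgeSet (G : WeightedGraph V) : Set (Sym2 V) := {e | 0 < G.weight e}

/-- The underlying simple graph. -/
def toSimpleGraph (G : WeightedGraph V) : SimpleGraph V where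
  Adj u v := s(u, v) ∈ G.edgeSet
  symm := ⟨fun u v h => by rwa [Sym2.eq_swap]⟩
  loopless := ⟨fun v h => by simp [edgeSet, G.weight_diag v] at h⟩

/-- The subgraph of `G` whose edges are the edges of `G` that lie in `S`, with the weights of `G`. -/
noncomputable def restrict (G : WeightedGraph V) (S : Set (Sym2 V)) : WeightedGraph V where
  weight := S.indicator G.weight
  weight_nonneg := Set.indicator_nonneg fun e _ => G.weight_nonneg e
  weight_diag v := by
    by_cases h : s(v, v) ∈ S
    · rw [Set.indicator_of_mem h, G.weight_diag v]
    · rw [Set.indicator_of_notMem h]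

/-- `G ∖ S`: the graph `G` with the edges in `S` removed. -/
noncomputable def deleteEdges (G : WeightedGraph V) (S : Set (Sym2 V)) : WeightedGraph V :=
  G.restrict Sᶜ

/-- `H` is a subgraph of `G` that inherits its edge weights from `G`. -/
def IsSubgraph (H G : WeightedGraph V) : Prop :=
  H.edgeSet ⊆ G.edgeSet ∧ ∀ e ∈ H.edgeSet, H.weight e = G.weight e

/-- The resistance of an edge is the inverse of its weight. -/
noncomputable def resistance (G : WeightedGraph V) (e : Sym2 V) : ℝ := 1 / G.weight e

/-- The length of a walk with respect to the resistances. -/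
noncomputable def walkLength (G : WeightedGraph V) {u v : V} (p : G.toSimpleGraph.Walk u v) : ℝ :=
  (p.edges.map G.resistance).sum

/-- The distance between two vertices with respect to the resistances; it is infinite if the
vertices are not connected. -/
noncomputable def dist (G : WeightedGraph V) (u v : V) : ENNReal :=
  ⨅ p : G.toSimpleGraph.Walk u v, ENNReal.ofReal (G.walkLength p)

/-- `H` is an `α`-spanner of `G`. -/
def IsSpanner (α : ℝ) (H G : WeightedGraph V) : Prop :=
  H.IsSubgraph G ∧ ∀ u v, H.dist u v ≤ ENNReal.ofReal α * G.dist u v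

/-- `B` is a `t`-bundle `α`-spanner of `G`: the union of graphs `T 0, …, T (t - 1)` such that each
`T i` is an `α`-spanner of `G` with the edges of all earlier `T j` removed. -/
def IsBundleSpanner (t : ℕ) (α : ℝ) (B G : WeightedGraph V) : Prop :=
  ∃ T : Fin t → WeightedGraph V,
    (∀ i, IsSpanner α (T i) (G.deleteEdges (⋃ j < i, (T j).edgeSet))) ∧
    B = G.restrict (⋃ i, (T i).edgeSet)

open Classical in
/-- The Laplacian matrix. -/
noncomputable def laplacian [Fintype V] (G : WeightedGraph V) : Matrix V V ℝ :=
  Matrix.of fun u v => if u = v then ∑ z, G.weight s(u, z) else -G.weight s(u, v)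

/-- `H` is a `(1 ± ε)`-spectral sparsifier of `G`. The edges of `H` are edges of `G`, but their
weights may differ. -/
def IsSpectralSparsifier [Fintype V] (ε : ℝ) (H G : WeightedGraph V) : Prop :=
  H.edgeSet ⊆ G.edgeSet ∧
  ∀ x : V → ℝ,
    (1 - ε) * (x ⬝ᵥ H.laplacian.mulVec x) ≤ x ⬝ᵥ G.laplacian.mulVec x ∧
    x ⬝ᵥ G.laplacian.mulVec x ≤ (1 + ε) * (x ⬝ᵥ H.laplacian.mulVec x)

end WeightedGraph

/-- The number `t = ⌈12 (c + 1) α ε⁻² ln n⌉` of spanners in the bundle kept by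
Light-Spectral-Sparsify on a graph with `n` vertices. -/
noncomputable def lightBundleSize (c α ε : ℝ) (n : ℕ) : ℕ :=
  ⌈12 * (c + 1) * α * (ε ^ 2)⁻¹ * Real.log n⌉₊

open Classical in
/-- The graph `H` that Light-Spectral-Sparsify returns on the input graph `G`, when `B` is the
bundle it has picked and `ξ e` is the outcome of the coin of `e`: the edges of `B` are kept with
their weights, and an edge `e` of `G ∖ B` is added with weight `4 w_G(e)` if its coin shows `true`,
and dropped otherwise. -/
noncomputable def lightSpectralSparsify {V : Type*} (G B : WeightedGraph V) (ξ : Sym2 V → Bool) :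
    WeightedGraph V where
  weight e :=
    if e ∈ B.edgeSet then B.weight e
    else if ξ e = true then 4 * G.weight e else 0
  weight_nonneg e := by
    have := G.weight_nonneg e
    have := B.weight_nonneg e
    split_ifs <;> linarith
  weight_diag v := by simp [B.weight_diag, G.weight_diag]

/-! Fix `G` and `B`, and write `a e` for the energy of an edge `e` outside `B`, that is, its weight
times the squared difference of `x` at its ends. Each of the `t` spanners in `B` joins the ends of
`e` by walks of resistance at most `α / w(e)` in the infimum, so Cauchy–Schwarz along a path gives
`a e ≤ α` times the energy of that spanner. The spanners are edge-disjoint subgraphs of `B`, so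
summing over them gives `a e ≤ (α / t) * B.energy x` (`IsBundleSpanner.mul_weight_mul_sqDiff_le`):
no single coin matters much relative to the Laplacian of `B`.

Each of the two sparsifier inequalities fails at `x` exactly when `ε * B.energy x` is less than a
sum of the `a e` with random coefficients. A kept or dropped edge has coefficient `-(3 + 4ε)` or `1`
in one case, `3 - 4ε` or `-1` in the other. In both cases the mean is `-ε`, and this negative drift
keeps the scalar exponential moment at most `1` on `[0, ε/6]` (`coin_mgf_lower_tail_le`,
`coin_mgf_upper_tail_le`).

The matrix Chernoff bound follows Ahlswede and Winter: `trace_exp_add_le` (Golden–Thompson) splits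
one coin off the trace exponential, and its averaged factor is at most the identity, so
`trace_exp_add_coin_le` shows that averaging over a coin does not increase the trace. Markov's
inequality then bounds each tail by `n * exp(-t ε² / (6α))`, and the choice of `t` makes the two
tails together at most `n ^ (-(c + 1))`. Independence of the coins from the input allows averaging
this bound over `G` and `B`. -/

/-! ### The Lie–Trotter product formula in a Banach algebra. -/

section LieTrotter

open NormedSpace Filter Topology

variable {𝔸 : Type*} [NormedRing 𝔸] [NormedAlgebra ℝ 𝔸] [NormOneClass 𝔸] [CompleteSpace 𝔸]

theorem NormedSpace.norm_exp_le_exp_norm (x : 𝔸) : ‖exp x‖ ≤ Real.exp ‖x‖ := by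
  have h1 := NormedSpace.exp_series_hasSum_exp' (𝕂 := ℝ) x
  have h2 := NormedSpace.exp_series_hasSum_exp' (𝕂 := ℝ) ‖x‖
  rw [← Real.exp_eq_exp_ℝ] at h2
  rw [← h1.tsum_eq]
  refine tsum_of_norm_bounded h2 fun n => ?_
  rw [norm_smul, smul_eq_mul, Real.norm_of_nonneg (by positivity)]
  gcongr
  exact norm_pow_le x n

/-- Telescoping: replacing the factors `x` by `y` one at a time costs `‖x - y‖` times at most `n`
factors of norm at most `K`. -/
theorem norm_pow_sub_pow_le_of_norm_le {R : Type*} [NormedRing R] [NormOneClass R] {x y : R}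
    {K : ℝ} (hx : ‖x‖ ≤ K) (hy : ‖y‖ ≤ K)
    (hK : 1 ≤ K) (n : ℕ) : ‖x ^ n - y ^ n‖ ≤ n * K ^ n * ‖x - y‖ := by
  induction n with
  | zero => simp
  | succ n ih =>
    have h : x ^ (n + 1) - y ^ (n + 1) = x * (x ^ n - y ^ n) + (x - y) * y ^ n := by
      rw [pow_succ', pow_succ']; noncomm_ring
    have hyn : ‖y ^ n‖ ≤ K ^ (n + 1) :=
      (norm_pow_le y n).trans
        ((pow_le_pow_left₀ (norm_nonneg y) hy n).trans (pow_le_pow_right₀ hK n.le_succ))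
    calc ‖x ^ (n + 1) - y ^ (n + 1)‖
        ≤ ‖x‖ * ‖x ^ n - y ^ n‖ + ‖x - y‖ * ‖y ^ n‖ := by
          rw [h]
          exact (norm_add_le _ _).trans (add_le_add (norm_mul_le _ _) (norm_mul_le _ _))
      _ ≤ K * (n * K ^ n * ‖x - y‖) + ‖x - y‖ * K ^ (n + 1) := by gcongr
      _ = (n + 1 : ℕ) * K ^ (n + 1) * ‖x - y‖ := by push_cast; ring

/-- The Lie–Trotter product formula. -/
theorem tendsto_exp_mul_exp_pow (A B : 𝔸) :
    Tendsto (fun n : ℕ => (exp ((n : ℝ)⁻¹ • A) * exp ((n : ℝ)⁻¹ • B)) ^ n) atTop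
      (𝓝 (exp (A + B))) := by
  let _ : NormedAlgebra ℚ 𝔸 := NormedAlgebra.restrictScalars ℚ ℝ 𝔸
  set f : ℝ → 𝔸 := fun t => exp (t • A) * exp (t • B) - exp (t • (A + B)) with hf
  have hder : HasDerivAt f 0 0 := by
    have hA := hasDerivAt_exp_smul_const (𝕂 := ℝ) A (0 : ℝ)
    have hB := hasDerivAt_exp_smul_const (𝕂 := ℝ) B (0 : ℝ)
    have hAB := hasDerivAt_exp_smul_const (𝕂 := ℝ) (A + B) (0 : ℝ)
    refine ((hA.mul hB).sub hAB).congr_deriv ?_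
    simp
  -- Both `f` and its derivative vanish at `0`, so the one-step error is `o(1/n)`; telescoping
  -- multiplies it only by `n` and a bounded constant.
  have hlim : Tendsto (fun n : ℕ => (n : ℝ) * ‖f ((n : ℝ)⁻¹)‖) atTop (𝓝 0) := by
    have h0 : f 0 = 0 := by simp [hf]
    have ht := hasDerivAt_iff_tendsto_slope_zero.1 hder
    have hn : Tendsto (fun n : ℕ => (n : ℝ)⁻¹) atTop (𝓝[≠] 0) :=
      tendsto_nhdsWithin_iff.2 ⟨tendsto_inv_atTop_nhds_zero_nat, by
        filter_upwards [eventually_gt_atTop 0] with n hn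
        simp [hn.ne']⟩
    have := (ht.comp hn).norm
    simpa [h0, norm_smul] using this
  rw [tendsto_iff_norm_sub_tendsto_zero]
  have hlim2 := hlim.const_mul (Real.exp (‖A‖ + ‖B‖))
  rw [mul_zero] at hlim2
  refine squeeze_zero' (Eventually.of_forall fun n => norm_nonneg _) ?_ hlim2
  filter_upwards [eventually_gt_atTop 0] with n hn
  have hn' : (0 : ℝ) < n := by exact_mod_cast hn
  have hexp : exp (A + B) = exp ((n : ℝ)⁻¹ • (A + B)) ^ n := by
    rw [← exp_nsmul, ← Nat.cast_smul_eq_nsmul ℝ, smul_smul, mul_inv_cancel₀ hn'.ne', one_smul]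
  set K := Real.exp ((n : ℝ)⁻¹ * (‖A‖ + ‖B‖)) with hK
  have hx : ‖exp ((n : ℝ)⁻¹ • A) * exp ((n : ℝ)⁻¹ • B)‖ ≤ K := by
    refine (norm_mul_le _ _).trans ?_
    rw [hK, mul_add, Real.exp_add]
    have hs (X : 𝔸) : (n : ℝ)⁻¹ * ‖X‖ = ‖(n : ℝ)⁻¹ • X‖ := by
      rw [norm_smul, Real.norm_of_nonneg (by positivity)]
    rw [hs, hs]
    gcongr <;> exact norm_exp_le_exp_norm _
  have hy : ‖exp ((n : ℝ)⁻¹ • (A + B))‖ ≤ K := by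
    refine (norm_exp_le_exp_norm _).trans (Real.exp_le_exp.2 ?_)
    rw [norm_smul, Real.norm_of_nonneg (by positivity)]
    gcongr
    exact norm_add_le A B
  have hK1 : 1 ≤ K := Real.one_le_exp (by positivity)
  have hKn : K ^ n = Real.exp (‖A‖ + ‖B‖) := by
    rw [hK, ← Real.exp_nat_mul, ← mul_assoc, mul_inv_cancel₀ hn'.ne', one_mul]
  rw [hexp]
  refine (norm_pow_sub_pow_le_of_norm_le hx hy hK1 n).trans (le_of_eq ?_)
  rw [hKn]
  ring

end LieTrotter

/-! ### Trace inequalities up to Golden–Thompson. -/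

namespace Matrix

open NormedSpace Filter Topology

variable {n : Type*} [Fintype n] [DecidableEq n]

theorem trace_mul_transpose_nonneg {n : Type*} [Fintype n] (X : Matrix n n ℝ) : 0 ≤ (X * Xᵀ).trace := by
  simp only [trace, diag_apply, mul_apply, transpose_apply]
  exact Finset.sum_nonneg fun i _ => Finset.sum_nonneg fun j _ => mul_self_nonneg _

theorem two_mul_trace_mul_le {n : Type*} [Fintype n] (X Y : Matrix n n ℝ) :
    2 * (X * Y).trace ≤ (X * Xᵀ).trace + (Y * Yᵀ).trace := by
  have h := trace_mul_transpose_nonneg (X - Yᵀ)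
  have h1 : (Yᵀ * Xᵀ).trace = (X * Y).trace := by rw [← transpose_mul, trace_transpose]
  have h2 : (Yᵀ * Y).trace = (Y * Yᵀ).trace := trace_mul_comm _ _
  simp only [transpose_sub, transpose_transpose, sub_mul, mul_sub, trace_sub, h1, h2] at h
  linarith

theorem trace_pow_mul_comm (X Y : Matrix n n ℝ) (k : ℕ) :
    ((X * Y) ^ k).trace = ((Y * X) ^ k).trace := by
  cases k with
  | zero => simp
  | succ k =>
    have h : (X * Y) ^ (k + 1) = X * ((Y * X) ^ k * Y) := by
      rw [pow_succ, ← mul_assoc, ← mul_assoc, mul_pow_mul]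
    rw [h, trace_mul_comm, pow_succ, mul_assoc]

/-- The two statements feed each other. For symmetric `P`, `Q`, the first applied to `P * Q`
produces `P * Q ^ 2 * P`, which is cyclically `P ^ 2 * Q ^ 2`, and the second finishes. For general
`M`, the first applied to `M ^ 2` produces cyclically `(M * Mᵀ) * (Mᵀ * M)`; the second and the
AM–GM bound for traces finish, as these two factors have equal traces of powers. -/
theorem trace_pow_two_pow_le_aux (k : ℕ) :
    (∀ M : Matrix n n ℝ, (M ^ 2 ^ (k + 1)).trace ≤ ((M * Mᵀ) ^ 2 ^ k).trace) ∧
    ∀ P Q : Matrix n n ℝ, P.IsSymm → Q.IsSymm →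
      ((P * Q) ^ 2 ^ k).trace ≤ (P ^ 2 ^ k * Q ^ 2 ^ k).trace := by
  induction k with
  | zero =>
    refine ⟨fun M => ?_, fun P Q _ _ => by simp⟩
    have := two_mul_trace_mul_le M M
    simp only [zero_add, pow_one, pow_zero, pow_two]
    linarith
  | succ k ih =>
    obtain ⟨ih1, ih2⟩ := ih
    have hmix (P Q : Matrix n n ℝ) (hP : P.IsSymm) (hQ : Q.IsSymm) :
        ((P * Q) ^ 2 ^ (k + 1)).trace ≤ (P ^ 2 ^ (k + 1) * Q ^ 2 ^ (k + 1)).trace := by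
      refine (ih1 (P * Q)).trans ?_
      have h : P * Q * (P * Q)ᵀ = P * (Q ^ 2 * P) := by
        rw [transpose_mul, hP.eq, hQ.eq, pow_two]; noncomm_ring
      have h' : Q ^ 2 * P * P = Q ^ 2 * P ^ 2 := by rw [mul_assoc, pow_two P]
      rw [h, trace_pow_mul_comm, h', trace_pow_mul_comm]
      refine (ih2 _ _ (hP.pow 2) (hQ.pow 2)).trans (le_of_eq ?_)
      rw [← pow_mul, ← pow_mul, ← pow_succ']
    refine ⟨fun M => ?_, hmix⟩
    set P := M * Mᵀ with hP
    set Q := Mᵀ * M with hQ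
    have hPs : P.IsSymm := by rw [hP, IsSymm, transpose_mul, transpose_transpose]
    have hQs : Q.IsSymm := by rw [hQ, IsSymm, transpose_mul, transpose_transpose]
    have h1 : (M ^ 2 ^ (k + 1 + 1)).trace ≤ ((P * Q) ^ 2 ^ k).trace := by
      rw [pow_succ' 2 (k + 1), pow_mul]
      refine (ih1 (M ^ 2)).trans (le_of_eq ?_)
      have h : M ^ 2 * (M ^ 2)ᵀ = M * (M * Mᵀ * Mᵀ) := by
        rw [pow_two, transpose_mul]; noncomm_ring
      have h' : M * Mᵀ * Mᵀ * M = P * Q := by rw [hP, hQ]; noncomm_ring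
      rw [h, trace_pow_mul_comm, h']
    have h2 := ih2 P Q hPs hQs
    have h3 := two_mul_trace_mul_le (P ^ 2 ^ k) (Q ^ 2 ^ k)
    rw [transpose_pow, transpose_pow, hPs.eq, hQs.eq, ← pow_add, ← pow_add, ← two_mul,
      ← pow_succ'] at h3
    have h4 : (Q ^ 2 ^ (k + 1)).trace = (P ^ 2 ^ (k + 1)).trace := trace_pow_mul_comm _ _ _
    linarith

/-- The Lieb–Thirring trace inequality for exponents that are powers of two. -/
theorem trace_mul_pow_two_pow_le {P Q : Matrix n n ℝ} (hP : P.IsSymm) (hQ : Q.IsSymm) (k : ℕ) :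
    ((P * Q) ^ 2 ^ k).trace ≤ (P ^ 2 ^ k * Q ^ 2 ^ k).trace :=
  (trace_pow_two_pow_le_aux k).2 P Q hP hQ

/-- The **Golden–Thompson inequality** for real symmetric matrices. -/
theorem trace_exp_add_le {A B : Matrix n n ℝ} (hA : A.IsSymm) (hB : B.IsSymm) :
    (exp (A + B)).trace ≤ (exp A * exp B).trace := by
  cases isEmpty_or_nonempty n with
  | inl h => simp [trace]
  | inr h =>
    -- Lie–Trotter along the exponents `2 ^ k`, the only ones for which Lieb–Thirring is available.
    have hlim : Tendsto (fun k : ℕ =>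
        ((exp (((2 ^ k : ℕ) : ℝ)⁻¹ • A) * exp (((2 ^ k : ℕ) : ℝ)⁻¹ • B)) ^ 2 ^ k).trace) atTop
        (𝓝 (exp (A + B)).trace) := by
      have h2 : Tendsto (fun k : ℕ => 2 ^ k) atTop atTop :=
        tendsto_pow_atTop_atTop_of_one_lt one_lt_two
      have h3 : Tendsto (fun m : ℕ => (exp ((m : ℝ)⁻¹ • A) * exp ((m : ℝ)⁻¹ • B)) ^ m) atTop
          (𝓝 (exp (A + B))) := open scoped Norms.Operator in tendsto_exp_mul_exp_pow A B
      exact ((continuous_id.matrix_trace.tendsto _).comp h3).comp h2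
    refine le_of_tendsto' hlim fun k => ?_
    have hpow (X : Matrix n n ℝ) : exp (((2 ^ k : ℕ) : ℝ)⁻¹ • X) ^ 2 ^ k = exp X := by
      rw [← exp_nsmul, ← Nat.cast_smul_eq_nsmul ℝ, smul_smul, mul_inv_cancel₀ (by positivity),
        one_smul]
    refine (trace_mul_pow_two_pow_le (hA.smul _).exp (hB.smul _).exp k).trans (le_of_eq ?_)
    rw [hpow, hpow]

end Matrix

/-! ### Spectral calculus and the effect of one coin on the trace exponential. -/

namespace Matrix

open NormedSpace

variable {n : Type*} [Fintype n] [DecidableEq n]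

theorem IsSymm.exists_diagonalization {A : Matrix n n ℝ} (hA : A.IsSymm) :
    ∃ (U : Matrix n n ℝ) (d : n → ℝ), U * Uᵀ = 1 ∧ Uᵀ * U = 1 ∧ A = U * diagonal d * Uᵀ := by
  have hA' : A.IsHermitian := by rwa [IsHermitian, conjTranspose_eq_transpose_of_trivial]
  have hU := hA'.eigenvectorUnitary.2
  refine ⟨hA'.eigenvectorUnitary, hA'.eigenvalues, ?_, ?_, ?_⟩
  · simpa [star_eq_conjTranspose] using (Unitary.mem_iff.1 hU).2
  · simpa [star_eq_conjTranspose] using (Unitary.mem_iff.1 hU).1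
  · have h := hA'.spectral_theorem
    rw [Unitary.conjStarAlgAut_apply] at h
    simpa [star_eq_conjTranspose, Function.comp_def] using h

theorem exp_mul_diagonal_mul_transpose {U : Matrix n n ℝ} (h1 : U * Uᵀ = 1) (d : n → ℝ) :
    exp (U * diagonal d * Uᵀ) = U * diagonal (fun i => Real.exp (d i)) * Uᵀ := by
  have hinv : U⁻¹ = Uᵀ := inv_eq_right_inv h1
  have hu : IsUnit U := (isUnit_iff_isUnit_det U).2 (isUnit_det_of_right_inverse h1)
  rw [← hinv, exp_conj U _ hu, exp_diagonal]
  congr 3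
  ext i
  rw [Pi.exp_def, Real.exp_eq_exp_ℝ]

theorem dotProduct_mul_diagonal_mul_transpose (U : Matrix n n ℝ) (d x : n → ℝ) :
    x ⬝ᵥ (U * diagonal d * Uᵀ) *ᵥ x = ∑ i, d i * (Uᵀ *ᵥ x) i ^ 2 := by
  rw [← mulVec_mulVec, ← mulVec_mulVec, dotProduct_mulVec, ← mulVec_transpose, dotProduct]
  refine Finset.sum_congr rfl fun i _ => ?_
  rw [mulVec_diagonal]
  ring

theorem sum_transpose_mulVec_sq {U : Matrix n n ℝ} (h1 : U * Uᵀ = 1) (x : n → ℝ) :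
    ∑ i, (Uᵀ *ᵥ x) i ^ 2 = x ⬝ᵥ x := by
  have h := dotProduct_mul_diagonal_mul_transpose U 1 x
  simp only [Pi.one_def, diagonal_one, mul_one, h1, one_mulVec, one_mul] at h
  exact h.symm

theorem exp_le_trace_exp {M : Matrix n n ℝ} (hM : M.IsSymm) {l : ℝ} {x : n → ℝ}
    (hx : l * (x ⬝ᵥ x) < x ⬝ᵥ M *ᵥ x) : Real.exp l ≤ (exp M).trace := by
  obtain ⟨U, d, h1, h2, rfl⟩ := hM.exists_diagonalization
  rw [exp_mul_diagonal_mul_transpose h1, trace_mul_comm, ← mul_assoc, h2, one_mul, trace_diagonal]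
  have hi : ∃ i, l < d i := by
    by_contra! h
    refine hx.not_ge ?_
    rw [dotProduct_mul_diagonal_mul_transpose, ← sum_transpose_mulVec_sq h1, Finset.mul_sum]
    exact Finset.sum_le_sum fun i _ => mul_le_mul_of_nonneg_right (h i) (sq_nonneg _)
  obtain ⟨i, hi⟩ := hi
  exact (Real.exp_le_exp.2 hi.le).trans
    (Finset.single_le_sum (f := fun i => Real.exp (d i)) (fun j _ => (Real.exp_pos _).le)
      (Finset.mem_univ i))

theorem PosSemidef.isSymm_real {n : Type*} {A : Matrix n n ℝ} (hA : A.PosSemidef) : A.IsSymm := by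
  have := hA.isHermitian
  rwa [IsHermitian, conjTranspose_eq_transpose_of_trivial] at this

theorem PosSemidef.trace_exp_mul_nonneg {P N : Matrix n n ℝ} (hP : P.IsSymm) (hN : N.PosSemidef) :
    0 ≤ (exp P * N).trace := by
  set E := exp ((2 : ℝ)⁻¹ • P) with hE
  have hEs : E.IsSymm := (hP.smul _).exp
  have h : exp P = E * E := by
    rw [hE, ← exp_add_of_commute _ _ (Commute.refl _), ← add_smul]
    norm_num
  have h' := (hN.conjTranspose_mul_mul_same E).trace_nonneg
  rw [conjTranspose_eq_transpose_of_trivial, hEs.eq] at h'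
  rwa [h, mul_assoc, trace_mul_comm]

/-- All matrices involved are diagonal in an eigenbasis of `A`, and the eigenvalues of `A` lie in
`[0, y]`, so the scalar inequality applies to each of them. -/
theorem posSemidef_one_sub_exp_smul {A : Matrix n n ℝ} (hA : A.PosSemidef) {y p s₁ s₂ : ℝ}
    (hAy : ∀ x, x ⬝ᵥ A *ᵥ x ≤ y * (x ⬝ᵥ x))
    (hs : ∀ z, 0 ≤ z → z ≤ y → p * Real.exp (s₁ * z) + (1 - p) * Real.exp (s₂ * z) ≤ 1) :
    (1 - (p • exp (s₁ • A) + (1 - p) • exp (s₂ • A))).PosSemidef := by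
  obtain ⟨U, d, h1, h2, hAU⟩ := hA.isSymm_real.exists_diagonalization
  have hvec (i : n) : Uᵀ *ᵥ (U *ᵥ Pi.single i 1) = Pi.single i 1 := by
    rw [mulVec_mulVec, h2, one_mulVec]
  have hquad (i : n) : (U *ᵥ Pi.single i 1) ⬝ᵥ A *ᵥ (U *ᵥ Pi.single i 1) = d i := by
    rw [hAU, dotProduct_mul_diagonal_mul_transpose, hvec]
    simp [Pi.single_apply]
  have hnorm (i : n) : (U *ᵥ Pi.single i 1) ⬝ᵥ (U *ᵥ Pi.single i 1) = 1 := by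
    rw [← sum_transpose_mulVec_sq h1, hvec]
    simp [Pi.single_apply]
  have hd0 (i : n) : 0 ≤ d i := by
    have := hA.dotProduct_mulVec_nonneg (U *ᵥ Pi.single i 1)
    rwa [star_trivial, hquad] at this
  have hdy (i : n) : d i ≤ y := by
    have := hAy (U *ᵥ Pi.single i 1)
    rwa [hquad, hnorm, mul_one] at this
  have hexp (s : ℝ) : exp (s • A) = U * diagonal (fun i => Real.exp (s * d i)) * Uᵀ := by
    rw [← exp_mul_diagonal_mul_transpose h1, hAU, ← smul_mul_assoc, ← mul_smul_comm,
      ← diagonal_smul]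
    rfl
  have hN : 1 - (p • exp (s₁ • A) + (1 - p) • exp (s₂ • A)) =
      U * diagonal (fun i => 1 - (p * Real.exp (s₁ * d i) + (1 - p) * Real.exp (s₂ * d i))) *
        Uᵀ := by
    rw [hexp, hexp]
    nth_rw 1 [← h1]
    have hdiag : diagonal (fun i => 1 - (p * Real.exp (s₁ * d i) + (1 - p) * Real.exp (s₂ * d i)))
        = 1 - (p • diagonal (fun i => Real.exp (s₁ * d i)) +
          (1 - p) • diagonal (fun i => Real.exp (s₂ * d i))) := by
      ext i j
      by_cases hij : i = j
      · subst hij; simp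
      · simp [hij]
    rw [hdiag]
    simp only [mul_sub, sub_mul, mul_add, add_mul, mul_one, mul_smul_comm, smul_mul_assoc]
  rw [hN]
  have := (PosSemidef.diagonal (d := fun i => 1 - (p * Real.exp (s₁ * d i) +
    (1 - p) * Real.exp (s₂ * d i))) fun i => by
      have := hs (d i) (hd0 i) (hdy i)
      simpa using this).mul_mul_conjTranspose_same U
  rwa [conjTranspose_eq_transpose_of_trivial] at this

/-- Golden–Thompson separates `exp S` from the coin. The average of the coin factors is below the
identity, and the trace pairing with the positive matrix `exp S` preserves this order. -/
theorem trace_exp_add_coin_le {S A : Matrix n n ℝ} (hS : S.IsSymm) (hA : A.PosSemidef)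
    {y p s₁ s₂ : ℝ} (hp0 : 0 ≤ p) (hp1 : p ≤ 1) (hAy : ∀ x, x ⬝ᵥ A *ᵥ x ≤ y * (x ⬝ᵥ x))
    (hs : ∀ z, 0 ≤ z → z ≤ y → p * Real.exp (s₁ * z) + (1 - p) * Real.exp (s₂ * z) ≤ 1) :
    p * (exp (S + s₁ • A)).trace + (1 - p) * (exp (S + s₂ • A)).trace ≤ (exp S).trace := by
  have h1 := trace_exp_add_le hS (hA.isSymm_real.smul s₁)
  have h2 := trace_exp_add_le hS (hA.isSymm_real.smul s₂)
  have h3 := (posSemidef_one_sub_exp_smul hA hAy hs).trace_exp_mul_nonneg hS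
  simp only [mul_sub, mul_add, mul_one, mul_smul_comm, trace_sub, trace_add, trace_smul,
    smul_eq_mul] at h3
  have h4 := mul_le_mul_of_nonneg_left h1 hp0
  have h5 := mul_le_mul_of_nonneg_left h2 (sub_nonneg.2 hp1)
  linarith

end Matrix

/-! ### Matrix Chernoff bounds for coin flips. -/

/-- The probability that a coin with success probability `p` shows `b`. -/
def coinWeight (p : ℝ) (b : Bool) : ℝ := if b = true then p else 1 - p

theorem coinWeight_nonneg {p : ℝ} (hp0 : 0 ≤ p) (hp1 : p ≤ 1) (b : Bool) : 0 ≤ coinWeight p b := by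
  unfold coinWeight
  split_ifs <;> linarith

namespace Matrix

open NormedSpace

variable {n : Type*} [Fintype n] [DecidableEq n]

/-- The matrix `S` is arbitrary so that the induction can absorb the first coin's term into it; the
remaining coins are averaged out first, then that one. -/
theorem sum_fin_coinWeight_trace_exp_le {p y : ℝ} (s : Bool → ℝ) (hp0 : 0 ≤ p) (hp1 : p ≤ 1)
    (hs : ∀ z, 0 ≤ z → z ≤ y →
      p * Real.exp (s true * z) + (1 - p) * Real.exp (s false * z) ≤ 1) (m : ℕ) :
    ∀ (A : Fin m → Matrix n n ℝ) (S : Matrix n n ℝ), (∀ i, (A i).PosSemidef) →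
      (∀ i x, x ⬝ᵥ A i *ᵥ x ≤ y * (x ⬝ᵥ x)) → S.IsSymm →
      ∑ ζ : Fin m → Bool, (∏ i, coinWeight p (ζ i)) * (exp (S + ∑ i, s (ζ i) • A i)).trace ≤
        (exp S).trace := by
  induction m with
  | zero => simp
  | succ m ih =>
    intro A S hA hAy hS
    have hstep (b : Bool) := ih (fun i => A i.succ) (S + s b • A 0) (fun i => hA _)
      (fun i => hAy _) (hS.add ((hA 0).isSymm_real.smul _))
    have hcoin := trace_exp_add_coin_le hS (hA 0) hp0 hp1 (hAy 0) hs
    calc _ = ∑ b : Bool, coinWeight p b * ∑ ζ : Fin m → Bool, (∏ i, coinWeight p (ζ i)) *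
          (exp (S + s b • A 0 + ∑ i, s (ζ i) • A i.succ)).trace := by
          rw [← (Fin.consEquiv fun _ => Bool).sum_comp, Fintype.sum_prod_type]
          refine Finset.sum_congr rfl fun b _ => ?_
          rw [Finset.mul_sum]
          refine Finset.sum_congr rfl fun ζ _ => ?_
          simp [Fin.prod_univ_succ, Fin.sum_univ_succ, Fin.consEquiv, mul_assoc, add_assoc]
      _ ≤ ∑ b : Bool, coinWeight p b * (exp (S + s b • A 0)).trace :=
          Finset.sum_le_sum fun b _ =>
            mul_le_mul_of_nonneg_left (hstep b) (coinWeight_nonneg hp0 hp1 b)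
      _ ≤ _ := by simpa [coinWeight] using hcoin

theorem sum_coinWeight_trace_exp_le {ι : Type*} [Fintype ι] [DecidableEq ι] {p y : ℝ}
    (s : Bool → ℝ) (hp0 : 0 ≤ p) (hp1 : p ≤ 1)
    (hs : ∀ z, 0 ≤ z → z ≤ y →
      p * Real.exp (s true * z) + (1 - p) * Real.exp (s false * z) ≤ 1)
    {A : ι → Matrix n n ℝ} {S : Matrix n n ℝ} (hA : ∀ i, (A i).PosSemidef)
    (hAy : ∀ i x, x ⬝ᵥ A i *ᵥ x ≤ y * (x ⬝ᵥ x)) (hS : S.IsSymm) :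
    ∑ ζ : ι → Bool, (∏ i, coinWeight p (ζ i)) * (exp (S + ∑ i, s (ζ i) • A i)).trace ≤
      (exp S).trace := by
  have e := Fintype.equivFin ι
  refine le_trans (le_of_eq ?_) (sum_fin_coinWeight_trace_exp_le s hp0 hp1 hs (Fintype.card ι)
    (fun i => A (e.symm i)) S (fun i => hA _) (fun i => hAy _) hS)
  refine Fintype.sum_equiv (e.arrowCongr (Equiv.refl Bool)) _ _ fun ζ => ?_
  congr 1
  · exact Fintype.prod_equiv e _ _ fun i => by simp
  · congr 3
    exact Fintype.sum_equiv e _ _ fun i => by simp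

/-- A matrix Chernoff bound for sums of independent positive semidefinite matrices with
coefficients decided by coin flips, relative to the identity. -/
theorem sum_coinWeight_le_card_mul_exp {ι : Type*} [Fintype ι] [DecidableEq ι] {p y : ℝ}
    (s : Bool → ℝ) (hp0 : 0 ≤ p) (hp1 : p ≤ 1)
    (hs : ∀ z, 0 ≤ z → z ≤ y →
      p * Real.exp (s true * z) + (1 - p) * Real.exp (s false * z) ≤ 1)
    {A : ι → Matrix n n ℝ} (hA : ∀ i, (A i).PosSemidef)
    (hAy : ∀ i x, x ⬝ᵥ A i *ᵥ x ≤ y * (x ⬝ᵥ x)) (l : ℝ) {T : Finset (ι → Bool)}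
    (hT : ∀ ζ ∈ T, ∃ x, l * (x ⬝ᵥ x) < x ⬝ᵥ (∑ i, s (ζ i) • A i) *ᵥ x) :
    ∑ ζ ∈ T, ∏ i, coinWeight p (ζ i) ≤ Fintype.card n * Real.exp (-l) := by
  have hsymm (ζ : ι → Bool) : (∑ i, s (ζ i) • A i).IsSymm := by
    rw [IsSymm, transpose_sum]
    exact Finset.sum_congr rfl fun i _ => (hA i).isSymm_real.smul _
  have hw (ζ : ι → Bool) : 0 ≤ ∏ i, coinWeight p (ζ i) :=
    Finset.prod_nonneg fun i _ => coinWeight_nonneg hp0 hp1 _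
  have hmain := sum_coinWeight_trace_exp_le s hp0 hp1 hs hA hAy (S := 0) isSymm_zero
  simp only [zero_add, exp_zero, trace_one] at hmain
  -- Markov's inequality: every outcome in `T` forces the trace exponential to be at least `exp l`,
  -- while its average is at most the trace of the identity.
  have hT' : Real.exp l * ∑ ζ ∈ T, ∏ i, coinWeight p (ζ i) ≤ Fintype.card n := by
    rw [Finset.mul_sum]
    refine (Finset.sum_le_sum fun ζ hζ => ?_).trans ((Finset.sum_le_univ_sum_of_nonneg
      fun ζ => mul_nonneg (hw ζ) ?_).trans hmain)
    · obtain ⟨x, hx⟩ := hT ζ hζ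
      rw [mul_comm]
      exact mul_le_mul_of_nonneg_left (exp_le_trace_exp (hsymm ζ) hx) (hw ζ)
    · have := PosSemidef.one (n := n) (R := ℝ) |>.trace_exp_mul_nonneg (hsymm ζ)
      rwa [mul_one] at this
  rw [Real.exp_neg, ← div_eq_mul_inv, le_div_iff₀' (Real.exp_pos l)]
  exact hT'

/-- With `K = Cᵀ * C`, congruence by `C⁻¹` turns bounds relative to `K` into bounds relative to the
identity. The scaling `y / r` then brings each matrix below `y` times the identity. -/
theorem sum_coinWeight_le_of_posDef {ι : Type*} [Fintype ι] [DecidableEq ι] {p y r : ℝ}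
    (s : Bool → ℝ) (hp0 : 0 ≤ p) (hp1 : p ≤ 1) (hy : 0 < y) (hr : 0 < r)
    (hs : ∀ z, 0 ≤ z → z ≤ y →
      p * Real.exp (s true * z) + (1 - p) * Real.exp (s false * z) ≤ 1)
    {K : Matrix n n ℝ} (hK : K.PosDef) {A : ι → Matrix n n ℝ} (hA : ∀ i, (A i).PosSemidef)
    (hAK : ∀ i x, x ⬝ᵥ A i *ᵥ x ≤ r * (x ⬝ᵥ K *ᵥ x)) (l : ℝ) {T : Finset (ι → Bool)}
    (hT : ∀ ζ ∈ T, ∃ x, l * (x ⬝ᵥ K *ᵥ x) < x ⬝ᵥ (∑ i, s (ζ i) • A i) *ᵥ x) :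
    ∑ ζ ∈ T, ∏ i, coinWeight p (ζ i) ≤ Fintype.card n * Real.exp (-(y / r * l)) := by
  obtain ⟨C, hC⟩ : ∃ C : Matrix n n ℝ, K = Cᵀ * C := by
    open scoped MatrixOrder Matrix.Norms.L2Operator in
    obtain ⟨C, hC⟩ := CStarAlgebra.nonneg_iff_eq_star_mul_self.mp hK.posSemidef.nonneg
    exact ⟨C, by simpa [star_eq_conjTranspose] using hC⟩
  have hCu : IsUnit C.det := by
    have := (isUnit_iff_isUnit_det K).1 hK.isUnit
    rw [hC, det_mul] at this
    exact isUnit_of_mul_isUnit_right this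
  have hconj (M : Matrix n n ℝ) (x : n → ℝ) :
      x ⬝ᵥ (C⁻¹ᵀ * M * C⁻¹) *ᵥ x = (C⁻¹ *ᵥ x) ⬝ᵥ M *ᵥ (C⁻¹ *ᵥ x) := by
    rw [← mulVec_mulVec, ← mulVec_mulVec, dotProduct_mulVec, ← mulVec_transpose,
      transpose_transpose]
  have hKC (x : n → ℝ) : x ⬝ᵥ K *ᵥ x = (C *ᵥ x) ⬝ᵥ (C *ᵥ x) := by
    rw [hC, ← mulVec_mulVec, dotProduct_mulVec, ← mulVec_transpose, transpose_transpose]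
  have hCC (x : n → ℝ) : C *ᵥ (C⁻¹ *ᵥ x) = x := by
    rw [mulVec_mulVec, mul_nonsing_inv _ hCu, one_mulVec]
  have hCC' (x : n → ℝ) : C⁻¹ *ᵥ (C *ᵥ x) = x := by
    rw [mulVec_mulVec, nonsing_inv_mul _ hCu, one_mulVec]
  have hq : 0 < y / r := div_pos hy hr
  refine sum_coinWeight_le_card_mul_exp s hp0 hp1 hs
    (A := fun i => (y / r) • (C⁻¹ᵀ * A i * C⁻¹)) (fun i => ?_) (fun i x => ?_) _ (fun ζ hζ => ?_)
  · have := (hA i).conjTranspose_mul_mul_same C⁻¹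
    rw [conjTranspose_eq_transpose_of_trivial] at this
    exact this.smul hq.le
  · have := hAK i (C⁻¹ *ᵥ x)
    rw [hKC, hCC] at this
    rw [smul_mulVec, dotProduct_smul, hconj, smul_eq_mul]
    calc _ ≤ y / r * (r * (x ⬝ᵥ x)) := by gcongr
      _ = y * (x ⬝ᵥ x) := by field_simp
  · obtain ⟨x, hx⟩ := hT ζ hζ
    refine ⟨C *ᵥ x, ?_⟩
    have hsum : ∑ i, s (ζ i) • (y / r) • (C⁻¹ᵀ * A i * C⁻¹) =
        (y / r) • (C⁻¹ᵀ * (∑ i, s (ζ i) • A i) * C⁻¹) := by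
      simp only [Finset.mul_sum, Finset.sum_mul, Finset.smul_sum, mul_smul_comm, smul_mul_assoc]
      exact Finset.sum_congr rfl fun i _ => smul_comm _ _ _
    rw [hsum, smul_mulVec, dotProduct_smul, hconj, hCC', smul_eq_mul, ← hKC, mul_assoc]
    gcongr

/-- A matrix Chernoff bound for sums of independent positive semidefinite matrices with
coefficients decided by coin flips, relative to a positive semidefinite matrix `K`. -/
theorem sum_coinWeight_le_of_posSemidef {ι : Type*} [Fintype ι] [DecidableEq ι] {p y r : ℝ}
    (s : Bool → ℝ) (hp0 : 0 ≤ p) (hp1 : p ≤ 1) (hy : 0 < y) (hr : 0 < r)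
    (hs : ∀ z, 0 ≤ z → z ≤ y →
      p * Real.exp (s true * z) + (1 - p) * Real.exp (s false * z) ≤ 1)
    {K : Matrix n n ℝ} (hK : K.PosSemidef) {A : ι → Matrix n n ℝ} (hA : ∀ i, (A i).PosSemidef)
    (hAK : ∀ i x, x ⬝ᵥ A i *ᵥ x ≤ r * (x ⬝ᵥ K *ᵥ x)) (l : ℝ) {T : Finset (ι → Bool)}
    (hT : ∀ ζ ∈ T, ∃ x, l * (x ⬝ᵥ K *ᵥ x) < x ⬝ᵥ (∑ i, s (ζ i) • A i) *ᵥ x) :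
    ∑ ζ ∈ T, ∏ i, coinWeight p (ζ i) ≤ Fintype.card n * Real.exp (-(y / r * l)) := by
  have hquad (η : ℝ) (x : n → ℝ) :
      x ⬝ᵥ (K + η • (1 : Matrix n n ℝ)) *ᵥ x = x ⬝ᵥ K *ᵥ x + η * (x ⬝ᵥ x) := by
    rw [add_mulVec, dotProduct_add, smul_mulVec, one_mulVec, dotProduct_smul, smul_eq_mul]
  -- The strict inequalities in `hT` concern finitely many outcomes, so they survive replacing `K`
  -- by the positive definite `K + η • 1` for small `η > 0`.
  have hη : ∀ᶠ η : ℝ in nhdsWithin 0 (Set.Ioi 0), ∀ ζ ∈ T, ∃ x,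
      l * (x ⬝ᵥ (K + η • (1 : Matrix n n ℝ)) *ᵥ x) < x ⬝ᵥ (∑ i, s (ζ i) • A i) *ᵥ x := by
    refine (Filter.eventually_all_finset T).2 fun ζ hζ => ?_
    obtain ⟨x, hx⟩ := hT ζ hζ
    have hcont : Continuous fun η : ℝ => l * (x ⬝ᵥ K *ᵥ x + η * (x ⬝ᵥ x)) := by fun_prop
    have hlt : ∀ᶠ η : ℝ in nhds 0,
        l * (x ⬝ᵥ K *ᵥ x + η * (x ⬝ᵥ x)) < x ⬝ᵥ (∑ i, s (ζ i) • A i) *ᵥ x :=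
      hcont.continuousAt.eventually_lt continuousAt_const (by simpa using hx)
    filter_upwards [hlt.filter_mono nhdsWithin_le_nhds] with η hη
    exact ⟨x, by rwa [hquad]⟩
  obtain ⟨η, hηT, hη0⟩ := (hη.and self_mem_nhdsWithin).exists
  refine sum_coinWeight_le_of_posDef s hp0 hp1 hy hr hs
    (K := K + η • (1 : Matrix n n ℝ)) (PosDef.posSemidef_add hK (PosDef.one.smul hη0)) hA (fun i x => (hAK i x).trans ?_) l hηT
  rw [hquad]
  have h1 : 0 ≤ x ⬝ᵥ x := by simpa using dotProduct_star_self_nonneg x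
  have h2 : 0 ≤ η * (x ⬝ᵥ x) := mul_nonneg (le_of_lt hη0) h1
  gcongr
  linarith

end Matrix

/-! ### The Laplacian form as a sum over edges. -/

theorem Fintype.sum_prod_sym2_mk {V M : Type*} [Fintype V] [AddCommMonoid M] (f : Sym2 V → M)
    (hf : ∀ v, f s(v, v) = 0) : ∑ p : V × V, f s(p.1, p.2) = 2 • ∑ e, f e := by
  classical
  rw [← Finset.sum_fiberwise Finset.univ (fun p : V × V => s(p.1, p.2)), Finset.smul_sum]
  refine Finset.sum_congr rfl fun e _ => ?_
  induction e using Sym2.ind with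
  | _ a b =>
    rw [Finset.sum_congr rfl fun p hp => by rw [(Finset.mem_filter.1 hp).2], Finset.sum_const]
    by_cases hab : a = b
    · subst hab
      simp [hf]
    · have : Finset.univ.filter (fun p : V × V => s(p.1, p.2) = s(a, b)) = {(a, b), (b, a)} := by
        ext p
        simp [Prod.ext_iff]
      rw [this, Finset.card_pair (by simp [Prod.ext_iff, hab])]

/-- The squared difference of the values of `x` at the ends of an edge. -/
def sqDiff {V : Type*} (x : V → ℝ) : Sym2 V → ℝ :=
  Sym2.lift ⟨fun u v => (x u - x v) ^ 2, fun u v => by ring⟩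

@[simp]
theorem sqDiff_mk {V : Type*} (x : V → ℝ) (u v : V) : sqDiff x s(u, v) = (x u - x v) ^ 2 := rfl

theorem sqDiff_nonneg {V : Type*} (x : V → ℝ) (e : Sym2 V) : 0 ≤ sqDiff x e := by
  induction e using Sym2.ind with
  | _ u v => exact sq_nonneg _

/-- The Laplacian matrix of a single edge of weight `1`. -/
def edgeLaplacian {V : Type*} [DecidableEq V] : Sym2 V → Matrix V V ℝ :=
  Sym2.lift ⟨fun u v => Matrix.vecMulVec (Pi.single u 1 - Pi.single v 1)
    (Pi.single u 1 - Pi.single v 1), fun u v => by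
      beta_reduce
      rw [← neg_sub (Pi.single v 1 : V → ℝ) (Pi.single u 1), Matrix.neg_vecMulVec, Matrix.vecMulVec_neg, neg_neg]⟩

theorem dotProduct_edgeLaplacian_mulVec {V : Type*} [Fintype V] [DecidableEq V] (e : Sym2 V)
    (x : V → ℝ) : x ⬝ᵥ (edgeLaplacian e).mulVec x = sqDiff x e := by
  induction e using Sym2.ind with
  | _ u v =>
    simp only [edgeLaplacian, Sym2.lift_mk, sqDiff_mk, Matrix.vecMulVec_mulVec,
      sub_dotProduct, single_one_dotProduct, op_smul_eq_smul, dotProduct_smul, dotProduct_sub,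
      dotProduct_single_one, smul_eq_mul]
    ring

theorem posSemidef_edgeLaplacian {V : Type*} [Fintype V] [DecidableEq V] (e : Sym2 V) :
    (edgeLaplacian e).PosSemidef := by
  induction e using Sym2.ind with
  | _ u v =>
    have := Matrix.posSemidef_vecMulVec_self_star (Pi.single u 1 - Pi.single v 1 : V → ℝ)
    rwa [star_trivial] at this

namespace WeightedGraph

variable {V : Type*}

/-- The quadratic form of the Laplacian. -/
def energy [Fintype V] [DecidableEq V] (G : WeightedGraph V) (x : V → ℝ) : ℝ :=
  ∑ e, G.weight e * sqDiff x e

theorem energy_nonneg [Fintype V] [DecidableEq V] (G : WeightedGraph V) (x : V → ℝ) :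
    0 ≤ G.energy x :=
  Finset.sum_nonneg fun e _ => mul_nonneg (G.weight_nonneg e) (sqDiff_nonneg x e)

theorem dotProduct_laplacian_mulVec [Fintype V] [DecidableEq V] (G : WeightedGraph V)
    (x : V → ℝ) : x ⬝ᵥ G.laplacian.mulVec x = G.energy x := by
  have h1 : x ⬝ᵥ G.laplacian.mulVec x =
      ∑ u, ∑ v, G.weight s(u, v) * (x u ^ 2 - x u * x v) := by
    refine Finset.sum_congr rfl fun u _ => ?_
    have h (v : V) : G.laplacian u v * x v =
        (if u = v then (∑ z, G.weight s(u, z)) * x v else 0) - G.weight s(u, v) * x v := by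
      rw [laplacian, Matrix.of_apply]
      by_cases huv : u = v
      · subst huv; simp [G.weight_diag]
      · simp [huv]
    rw [Matrix.mulVec, dotProduct, Finset.sum_congr rfl fun v _ => h v, Finset.sum_sub_distrib,
      Finset.sum_ite_eq, if_pos (Finset.mem_univ u), mul_sub, Finset.sum_mul, Finset.mul_sum,
      Finset.mul_sum, ← Finset.sum_sub_distrib]
    exact Finset.sum_congr rfl fun v _ => by ring
  have h2 : ∑ u, ∑ v, G.weight s(u, v) * (x u ^ 2 - x u * x v) =
      ∑ u, ∑ v, G.weight s(u, v) * (x v ^ 2 - x u * x v) := by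
    rw [Finset.sum_comm]
    exact Finset.sum_congr rfl fun u _ => Finset.sum_congr rfl fun v _ => by
      rw [Sym2.eq_swap]; ring
  have h3 : ∑ u, ∑ v, G.weight s(u, v) * (x u ^ 2 - x u * x v) +
      ∑ u, ∑ v, G.weight s(u, v) * (x v ^ 2 - x u * x v) = 2 * G.energy x := by
    have h := Fintype.sum_prod_sym2_mk (fun e => G.weight e * sqDiff x e)
      fun v => by simp [G.weight_diag]
    rw [Fintype.sum_prod_type, nsmul_eq_mul, Nat.cast_ofNat] at h
    rw [energy, ← h]
    simp only [← Finset.sum_add_distrib, sqDiff_mk]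
    exact Finset.sum_congr rfl fun u _ => Finset.sum_congr rfl fun v _ => by ring
  linarith

theorem posSemidef_laplacian [Fintype V] (G : WeightedGraph V) : G.laplacian.PosSemidef := by
  classical
  refine Matrix.PosSemidef.of_dotProduct_mulVec_nonneg ?_ fun x => ?_
  · ext u v
    simp only [Matrix.conjTranspose_apply, laplacian, Matrix.of_apply, star_trivial]
    by_cases huv : u = v
    · subst huv; rfl
    · rw [if_neg huv, if_neg (Ne.symm huv), Sym2.eq_swap]
  · rw [star_trivial, dotProduct_laplacian_mulVec]
    exact G.energy_nonneg x

/-! ### Energy of an edge against the energy of spanners and bundles. -/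

theorem resistance_nonneg (G : WeightedGraph V) (e : Sym2 V) : 0 ≤ G.resistance e :=
  one_div_nonneg.2 (G.weight_nonneg e)

/-- Cauchy–Schwarz for two resistors in series; it is the inductive step along a walk. -/
theorem sq_add_le_add_mul_add {a b r₁ r₂ e₁ e₂ : ℝ} (hr₁ : 0 ≤ r₁) (hr₂ : 0 ≤ r₂) (he₁ : 0 ≤ e₁)
    (he₂ : 0 ≤ e₂) (ha : a ^ 2 ≤ r₁ * e₁) (hb : b ^ 2 ≤ r₂ * e₂) :
    (a + b) ^ 2 ≤ (r₁ + r₂) * (e₁ + e₂) := by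
  have h1 : (2 * (a * b)) ^ 2 ≤ (r₁ * e₂ + r₂ * e₁) ^ 2 := by
    have := mul_le_mul ha hb (sq_nonneg b) (mul_nonneg hr₁ he₁)
    nlinarith [sq_nonneg (r₁ * e₂ - r₂ * e₁)]
  have h2 := le_of_abs_le (abs_le_of_sq_le_sq h1 (by positivity))
  nlinarith

theorem sq_sub_le_walkLength_mul (G : WeightedGraph V) (x : V → ℝ) {u v : V}
    (p : G.toSimpleGraph.Walk u v) :
    (x u - x v) ^ 2 ≤ G.walkLength p * (p.edges.map fun e => G.weight e * sqDiff x e).sum := by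
  have hr {u v : V} (p : G.toSimpleGraph.Walk u v) : 0 ≤ G.walkLength p :=
    List.sum_nonneg fun a ha => by
      obtain ⟨e, _, rfl⟩ := List.mem_map.1 ha
      exact G.resistance_nonneg e
  have he {u v : V} (p : G.toSimpleGraph.Walk u v) :
      0 ≤ (p.edges.map fun e => G.weight e * sqDiff x e).sum :=
    List.sum_nonneg fun a ha => by
      obtain ⟨e, _, rfl⟩ := List.mem_map.1 ha
      exact mul_nonneg (G.weight_nonneg e) (sqDiff_nonneg x e)
  induction p with
  | nil => simp [walkLength]
  | @cons u w v h p ih =>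
    have hw : 0 < G.weight s(u, w) := h
    have h1 : (x u - x w) ^ 2 ≤
        G.resistance s(u, w) * (G.weight s(u, w) * sqDiff x s(u, w)) := by
      rw [resistance, ← mul_assoc, one_div_mul_cancel hw.ne', one_mul, sqDiff_mk]
    have := sq_add_le_add_mul_add (G.resistance_nonneg _) (hr p)
      (mul_nonneg hw.le (sqDiff_nonneg x _)) (he p) h1 ih
    rw [sub_add_sub_cancel] at this
    simpa [walkLength] using this

/-- A walk may repeat edges, so its energy sum need not be below that of `G`. Bypassing it to a path
makes the edges distinct and does not increase the length. -/
theorem sq_sub_le_walkLength_mul_energy [Fintype V] [DecidableEq V] (G : WeightedGraph V)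
    (x : V → ℝ) {u v : V} (p : G.toSimpleGraph.Walk u v) :
    (x u - x v) ^ 2 ≤ G.walkLength p * G.energy x := by
  have hnodup : p.bypass.edges.Nodup := p.bypass_isPath.isTrail.edges_nodup
  have hlen : G.walkLength p.bypass ≤ G.walkLength p := by
    obtain ⟨l, hl, hsub⟩ := hnodup.subperm p.edges_bypass_subset_edges
    rw [walkLength, ← (hl.map G.resistance).sum_eq]
    refine (hsub.map G.resistance).sum_le_sum fun a ha => ?_
    obtain ⟨e, _, rfl⟩ := List.mem_map.1 ha
    exact G.resistance_nonneg e
  have henergy : (p.bypass.edges.map fun e => G.weight e * sqDiff x e).sum ≤ G.energy x := by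
    rw [← List.sum_toFinset _ hnodup]
    exact Finset.sum_le_univ_sum_of_nonneg fun e =>
      mul_nonneg (G.weight_nonneg e) (sqDiff_nonneg x e)
  have hlen0 : 0 ≤ G.walkLength p.bypass := List.sum_nonneg fun a ha => by
    obtain ⟨e, _, rfl⟩ := List.mem_map.1 ha
    exact G.resistance_nonneg e
  calc (x u - x v) ^ 2 ≤ _ := G.sq_sub_le_walkLength_mul x p.bypass
    _ ≤ G.walkLength p.bypass * G.energy x := by gcongr
    _ ≤ G.walkLength p * G.energy x := mul_le_mul_of_nonneg_right hlen (G.energy_nonneg x)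

theorem dist_le_resistance (G : WeightedGraph V) {u v : V} (h : s(u, v) ∈ G.edgeSet) :
    G.dist u v ≤ ENNReal.ofReal (G.resistance s(u, v)) := by
  have hadj : G.toSimpleGraph.Adj u v := h
  refine (iInf_le _ hadj.toWalk).trans (le_of_eq ?_)
  simp [walkLength]

/-- Every edge of `G` has energy at most `α` times the energy of an `α`-spanner of `G`. -/
theorem IsSpanner.weight_mul_sqDiff_le [Fintype V] [DecidableEq V] {α : ℝ} (hα : 0 ≤ α)
    {T G : WeightedGraph V} (h : IsSpanner α T G) (x : V → ℝ) (e : Sym2 V) :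
    G.weight e * sqDiff x e ≤ α * T.energy x := by
  obtain he | he := (G.weight_nonneg e).eq_or_lt'
  · rw [he, zero_mul]
    exact mul_nonneg hα (T.energy_nonneg x)
  induction e using Sym2.ind with
  | _ u v =>
    have hdist : T.dist u v ≤ ENNReal.ofReal (α * G.resistance s(u, v)) := by
      rw [ENNReal.ofReal_mul hα]
      exact (h.2 u v).trans (mul_le_mul_right (G.dist_le_resistance he) _)
    rw [sqDiff_mk]
    -- If `T` has zero energy at `x`, dividing by it is impossible, but finiteness of the distance
    -- supplies a walk, along which `x` has equal end values.
    obtain hE | hE := (T.energy_nonneg x).eq_or_lt'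
    · obtain ⟨p⟩ : Nonempty (T.toSimpleGraph.Walk u v) := by
        by_contra hne
        rw [not_nonempty_iff] at hne
        rw [dist, iInf_of_empty] at hdist
        exact absurd hdist (by simp)
      have := T.sq_sub_le_walkLength_mul_energy x p
      rw [hE, mul_zero] at this ⊢
      exact mul_nonpos_of_nonneg_of_nonpos he.le this
    · have hle : ENNReal.ofReal ((x u - x v) ^ 2 / T.energy x) ≤ T.dist u v :=
        le_iInf fun p => ENNReal.ofReal_le_ofReal
          ((div_le_iff₀ hE).2 (T.sq_sub_le_walkLength_mul_energy x p))
      have := (ENNReal.ofReal_le_ofReal_iff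
        (mul_nonneg hα (G.resistance_nonneg _))).1 (hle.trans hdist)
      rw [resistance, div_le_iff₀ hE] at this
      calc G.weight s(u, v) * (x u - x v) ^ 2
          ≤ G.weight s(u, v) * (α * (1 / G.weight s(u, v)) * T.energy x) := by gcongr
        _ = α * T.energy x := by field_simp

theorem restrict_weight_of_mem (G : WeightedGraph V) {S : Set (Sym2 V)} {e : Sym2 V}
    (h : e ∈ S) : (G.restrict S).weight e = G.weight e :=
  Set.indicator_of_mem h _

theorem restrict_weight_of_notMem (G : WeightedGraph V) {S : Set (Sym2 V)} {e : Sym2 V}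
    (h : e ∉ S) : (G.restrict S).weight e = 0 :=
  Set.indicator_of_notMem h _

theorem IsBundleSpanner.weight_eq {t : ℕ} {α : ℝ} {B G : WeightedGraph V}
    (h : IsBundleSpanner t α B G) {e : Sym2 V} (he : e ∈ B.edgeSet) : B.weight e = G.weight e := by
  obtain ⟨T, -, rfl⟩ := h
  by_cases hS : e ∈ ⋃ i, (T i).edgeSet
  · exact G.restrict_weight_of_mem hS
  · exact absurd (G.restrict_weight_of_notMem hS) he.ne'

/-- Every edge outside of a `t`-bundle `α`-spanner has energy at most `α / t` times the energy of
the bundle. -/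
theorem IsBundleSpanner.mul_weight_mul_sqDiff_le [Fintype V] [DecidableEq V] {t : ℕ} {α : ℝ}
    (hα : 0 ≤ α) {B G : WeightedGraph V} (h : IsBundleSpanner t α B G) (x : V → ℝ) {e : Sym2 V}
    (he : e ∉ B.edgeSet) : t * (G.weight e * sqDiff x e) ≤ α * B.energy x := by
  obtain he0 | he0 := (G.weight_nonneg e).eq_or_lt'
  · rw [he0, zero_mul, mul_zero]
    exact mul_nonneg hα (B.energy_nonneg x)
  obtain ⟨T, hT, rfl⟩ := h
  have heT (i : Fin t) : e ∉ (T i).edgeSet := fun hi => he <| by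
    have : e ∈ ⋃ i, (T i).edgeSet := Set.mem_iUnion.2 ⟨i, hi⟩
    exact he0.trans_eq (G.restrict_weight_of_mem this).symm
  have hstep (i : Fin t) : G.weight e * sqDiff x e ≤ α * (T i).energy x := by
    have := (hT i).weight_mul_sqDiff_le hα x e
    rwa [deleteEdges, restrict_weight_of_mem] at this
    simp only [Set.mem_compl_iff, Set.mem_iUnion, not_exists]
    exact fun j _ => heT j
  have hsum : ∑ i, (T i).energy x ≤ (G.restrict (⋃ i, (T i).edgeSet)).energy x := by
    simp only [energy]
    rw [Finset.sum_comm]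
    refine Finset.sum_le_sum fun f _ => ?_
    rw [← Finset.sum_mul]
    refine mul_le_mul_of_nonneg_right ?_ (sqDiff_nonneg x f)
    -- An edge of `T i` has positive weight after the deletions, so it lies in no earlier `T j`;
    -- hence the spanners are edge-disjoint.
    have hdel {i : Fin t} (hi : f ∈ (T i).edgeSet) : (∀ j < i, f ∉ (T j).edgeSet) ∧
        (T i).weight f = G.weight f := by
      have h1 := (hT i).1.1 hi
      have h2 : f ∈ (⋃ j < i, (T j).edgeSet)ᶜ := by
        by_contra hf
        exact h1.ne' (restrict_weight_of_notMem _ hf)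
      refine ⟨by simpa using h2, ?_⟩
      rw [(hT i).1.2 f hi, deleteEdges, restrict_weight_of_mem _ h2]
    have hzero {i : Fin t} (hi : f ∉ (T i).edgeSet) : (T i).weight f = 0 :=
      le_antisymm (not_lt.1 hi) ((T i).weight_nonneg f)
    by_cases hf : f ∈ ⋃ i, (T i).edgeSet
    · obtain ⟨i, hi⟩ := Set.mem_iUnion.1 hf
      rw [G.restrict_weight_of_mem hf, Finset.sum_eq_single i, (hdel hi).2]
      · intro j _ hji
        refine hzero fun hj => ?_
        obtain hlt | hlt := lt_or_gt_of_ne hji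
        · exact (hdel hi).1 j hlt hj
        · exact (hdel hj).1 i hlt hi
      · simp
    · rw [G.restrict_weight_of_notMem hf]
      exact (Finset.sum_eq_zero fun i _ => hzero fun hi => hf (Set.mem_iUnion.2 ⟨i, hi⟩)).le
  calc t * (G.weight e * sqDiff x e) = ∑ _i : Fin t, G.weight e * sqDiff x e := by simp
    _ ≤ ∑ i, α * (T i).energy x := Finset.sum_le_sum fun i _ => hstep i
    _ = α * ∑ i, (T i).energy x := by rw [Finset.mul_sum]
    _ ≤ _ := by gcongr

end WeightedGraph

/-! ### Scalar exponential moments and the choice of the bundle size. -/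

theorem coin_mgf_lower_tail_le {ε z : ℝ} (hε1 : ε ≤ 1) (hz : 0 ≤ z) (hzε : z ≤ ε / 6) :
    1 / 4 * Real.exp (-(3 + 4 * ε) * z) + (1 - 1 / 4) * Real.exp (1 * z) ≤ 1 := by
  -- Since `ε ≥ 6 * z`, the exponent satisfies `(3 + 4 * ε) * z ≥ v`, which eliminates `ε`.
  set v := 3 * z + 24 * z ^ 2 with hv
  have hz6 : z ≤ 1 / 6 := by linarith
  have hv0 : 0 ≤ v := by positivity
  have h1 : Real.exp (-(3 + 4 * ε) * z) ≤ (1 + v + v ^ 2 / 2)⁻¹ := by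
    calc Real.exp (-(3 + 4 * ε) * z) ≤ Real.exp (-v) := Real.exp_le_exp.2 (by nlinarith)
      _ = (Real.exp v)⁻¹ := Real.exp_neg v
      _ ≤ _ := inv_anti₀ (by positivity) (Real.quadratic_le_exp_of_nonneg hv0)
  have h2 : Real.exp (1 * z) ≤ (1 - z)⁻¹ := by
    rw [one_mul, ← inv_inv (Real.exp z), ← Real.exp_neg]
    exact inv_anti₀ (by linarith) (Real.one_sub_le_exp_neg z)
  have h3 : (1 + v + v ^ 2 / 2)⁻¹ ≤ 4 - 3 * (1 - z)⁻¹ := by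
    have hz1 : 0 < 1 - z := by linarith
    have h4 : 4 - 3 * (1 - z)⁻¹ = (1 - 4 * z) / (1 - z) := by field_simp; ring
    rw [h4, inv_eq_one_div, div_le_div_iff₀ (by positivity) hz1]
    have h5 : 0 ≤ z ^ 2 * (33 / 2 - 42 * z - 288 * z ^ 2) :=
      mul_nonneg (sq_nonneg z) (by nlinarith)
    have h6 : 0 ≤ (1 - 4 * z) * (288 * z ^ 4) := mul_nonneg (by linarith) (by positivity)
    have h7 : (1 - 4 * z) * (1 + v + v ^ 2 / 2) - (1 - z) =
        z ^ 2 * (33 / 2 - 42 * z - 288 * z ^ 2) + (1 - 4 * z) * (288 * z ^ 4) := by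
      rw [hv]; ring
    linarith
  linarith

theorem coin_mgf_upper_tail_le {ε z : ℝ} (hε1 : ε ≤ 1) (hz : 0 ≤ z) (hzε : z ≤ ε / 6) :
    1 / 4 * Real.exp ((3 - 4 * ε) * z) + (1 - 1 / 4) * Real.exp (-1 * z) ≤ 1 := by
  -- Again `ε ≥ 6 * z` gives `(3 - 4 * ε) * z ≤ u`. The drift term `-24 * z ^ 2` outweighs the
  -- second-order terms of both exponentials.
  set u := 3 * z - 24 * z ^ 2 with hu
  have hz6 : z ≤ 1 / 6 := by linarith
  have hexp {y : ℝ} (hy : |y| ≤ 1) : Real.exp y ≤ 1 + y + y ^ 2 := by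
    have := (abs_le.1 (Real.abs_exp_sub_one_sub_id_le hy)).2
    linarith
  have h1 : Real.exp ((3 - 4 * ε) * z) ≤ 1 + u + u ^ 2 :=
    (Real.exp_le_exp.2 (by nlinarith)).trans (hexp (abs_le.2 ⟨by nlinarith, by nlinarith⟩))
  have h2 : Real.exp (-1 * z) ≤ 1 + -1 * z + (-1 * z) ^ 2 :=
    hexp (abs_le.2 ⟨by linarith, by linarith⟩)
  have h3 : u ^ 2 ≤ 9 * z ^ 2 := by
    have : u ^ 2 = z ^ 2 * (3 - 24 * z) ^ 2 := by rw [hu]; ring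
    have h4 : (3 - 24 * z) ^ 2 ≤ 9 := by nlinarith
    nlinarith [sq_nonneg z]
  nlinarith [sq_nonneg z]

/-- The constant `12` is `6 * 2`: the `6` cancels the range `ε / 6` of the moment bounds, and the
`2` makes the exponential at most `n ^ (-2 * (c + 1))`. Half of that exponent pays for the factor `2
* n` from the two tails and the dimension, as `2 * n ≤ n ^ 2 ≤ n ^ (c + 1)`. -/
theorem two_mul_card_mul_exp_le {c α ε : ℝ} (hc : 1 ≤ c) (hα : 1 ≤ α) (hε : 0 < ε) {n : ℕ}
    (hn : 2 ≤ n) :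
    0 < lightBundleSize c α ε n ∧
    2 * (n * Real.exp (-(ε / 6 / (α / lightBundleSize c α ε n) * ε))) ≤
      (n : ℝ) ^ (-(c + 1)) := by
  have hn2 : (2 : ℝ) ≤ n := by exact_mod_cast hn
  have hn0 : (0 : ℝ) < n := by linarith
  have hlog : 0 < Real.log n := Real.log_pos (by linarith)
  have hα0 : 0 < α := by linarith
  set t := lightBundleSize c α ε n with ht
  have hle : 12 * (c + 1) * α * (ε ^ 2)⁻¹ * Real.log n ≤ t := Nat.le_ceil _
  have hpos : 0 < 12 * (c + 1) * α * (ε ^ 2)⁻¹ * Real.log n := by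
    have : 0 < c + 1 := by linarith
    positivity
  refine ⟨by exact_mod_cast hpos.trans_le hle, ?_⟩
  have hexp : 2 * (c + 1) * Real.log n ≤ ε / 6 / (α / t) * ε := by
    have h1 : ε / 6 / (α / t) * ε = ε ^ 2 / (6 * α) * t := by field_simp
    have h2 : 2 * (c + 1) * Real.log n =
        ε ^ 2 / (6 * α) * (12 * (c + 1) * α * (ε ^ 2)⁻¹ * Real.log n) := by field_simp; ring
    rw [h1, h2]
    gcongr
  have hsq : 2 * (n : ℝ) ≤ Real.exp ((c + 1) * Real.log n) := by
    calc 2 * (n : ℝ) ≤ n * n := by gcongr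
      _ = Real.exp (Real.log n + Real.log n) := by rw [Real.exp_add, Real.exp_log hn0]
      _ ≤ _ := Real.exp_le_exp.2 (by nlinarith)
  calc 2 * (n * Real.exp (-(ε / 6 / (α / t) * ε)))
      ≤ 2 * (n * Real.exp (-(2 * (c + 1) * Real.log n))) := by gcongr
    _ = 2 * n * Real.exp (-(2 * (c + 1) * Real.log n)) := by ring
    _ ≤ Real.exp ((c + 1) * Real.log n) * Real.exp (-(2 * (c + 1) * Real.log n)) := by gcongr
    _ = (n : ℝ) ^ (-(c + 1)) := by
      rw [← Real.exp_add, Real.rpow_def_of_pos hn0]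
      ring_nf

/-! ### Failure probability for a fixed graph and bundle. -/

namespace WeightedGraph

variable {V : Type*} [Fintype V] [DecidableEq V]

open Classical in
/-- The weight of an edge of `G` outside of `B`. -/
noncomputable def outsideWeight (G B : WeightedGraph V) (e : Sym2 V) : ℝ :=
  if e ∈ B.edgeSet then 0 else G.weight e

theorem outsideWeight_nonneg {V : Type*} (G B : WeightedGraph V) (e : Sym2 V) :
    0 ≤ G.outsideWeight B e := by
  unfold outsideWeight
  split_ifs
  exacts [le_rfl, G.weight_nonneg e]

theorem weight_eq_zero_of_notMem {V : Type*} {G : WeightedGraph V} {e : Sym2 V} (h : e ∉ G.edgeSet) :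
    G.weight e = 0 :=
  le_antisymm (not_lt.1 h) (G.weight_nonneg e)

theorem energy_eq_add_outside {G B : WeightedGraph V}
    (h : ∀ e ∈ B.edgeSet, B.weight e = G.weight e) (x : V → ℝ) :
    G.energy x = B.energy x + ∑ e, G.outsideWeight B e * sqDiff x e := by
  rw [energy, energy, ← Finset.sum_add_distrib]
  refine Finset.sum_congr rfl fun e _ => ?_
  by_cases he : e ∈ B.edgeSet
  · simp [outsideWeight, he, h e he]
  · simp [outsideWeight, he, weight_eq_zero_of_notMem he]

theorem energy_lightSpectralSparsify (G B : WeightedGraph V) (ζ : Sym2 V → Bool) (x : V → ℝ) :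
    (lightSpectralSparsify G B ζ).energy x =
      B.energy x + ∑ e, (if ζ e = true then 4 else 0) * (G.outsideWeight B e * sqDiff x e) := by
  rw [energy, energy, ← Finset.sum_add_distrib]
  refine Finset.sum_congr rfl fun e _ => ?_
  by_cases he : e ∈ B.edgeSet
  · simp [lightSpectralSparsify, outsideWeight, he]
  · by_cases hζ : ζ e = true
    · simp [lightSpectralSparsify, outsideWeight, he, weight_eq_zero_of_notMem he, hζ, mul_assoc]
    · simp [lightSpectralSparsify, outsideWeight, he, weight_eq_zero_of_notMem he, hζ]

theorem edgeSet_lightSpectralSparsify_subset {V : Type*} {G B : WeightedGraph V}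
    (h : ∀ e ∈ B.edgeSet, B.weight e = G.weight e) (ζ : Sym2 V → Bool) :
    (lightSpectralSparsify G B ζ).edgeSet ⊆ G.edgeSet := by
  intro e he
  by_cases heB : e ∈ B.edgeSet
  · exact (show 0 < B.weight e from heB).trans_eq (h e heB)
  · by_contra hG
    refine (show 0 < (lightSpectralSparsify G B ζ).weight e from he).ne' ?_
    simp [lightSpectralSparsify, heB, weight_eq_zero_of_notMem hG]

open Classical in
/-- For a fixed graph and bundle, the coins make Light-Spectral-Sparsify fail with probability at
most `n ^ (-(c + 1))`. -/
theorem sum_coinWeight_not_isSpectralSparsifier_le {c α ε : ℝ} (hc : 1 ≤ c) (hα : 1 ≤ α)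
    (hε : 0 < ε) (hε1 : ε ≤ 1) (hn : 2 ≤ Fintype.card V) {G B : WeightedGraph V}
    (h : IsBundleSpanner (lightBundleSize c α ε (Fintype.card V)) α B G) :
    ∑ ζ : Sym2 V → Bool with ¬ IsSpectralSparsifier ε (lightSpectralSparsify G B ζ) G,
      ∏ e, coinWeight (1 / 4) (ζ e) ≤ (Fintype.card V : ℝ) ^ (-(c + 1)) := by
  obtain ⟨ht, hbound⟩ := two_mul_card_mul_exp_le hc hα hε hn
  set t := lightBundleSize c α ε (Fintype.card V)
  have hα0 : 0 < α := by linarith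
  have ht0 : (0 : ℝ) < t := by exact_mod_cast ht
  set A : Sym2 V → Matrix V V ℝ := fun e => G.outsideWeight B e • edgeLaplacian e with hAdef
  have hAquad (e : Sym2 V) (x : V → ℝ) :
      x ⬝ᵥ (A e).mulVec x = G.outsideWeight B e * sqDiff x e := by
    rw [hAdef, Matrix.smul_mulVec, dotProduct_smul, dotProduct_edgeLaplacian_mulVec, smul_eq_mul]
  have hA (e : Sym2 V) : (A e).PosSemidef :=
    (posSemidef_edgeLaplacian e).smul (G.outsideWeight_nonneg B e)
  have hAB (e : Sym2 V) (x : V → ℝ) :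
      x ⬝ᵥ (A e).mulVec x ≤ α / t * (x ⬝ᵥ B.laplacian.mulVec x) := by
    rw [hAquad, dotProduct_laplacian_mulVec, outsideWeight]
    split_ifs with he
    · rw [zero_mul]
      exact mul_nonneg (by positivity) (B.energy_nonneg x)
    · rw [div_mul_eq_mul_div, le_div_iff₀' ht0]
      exact h.mul_weight_mul_sqDiff_le hα0.le x he
  have hsum (s : Bool → ℝ) (ζ : Sym2 V → Bool) (x : V → ℝ) :
      x ⬝ᵥ (∑ e, s (ζ e) • A e).mulVec x =
        ∑ e, s (ζ e) * (G.outsideWeight B e * sqDiff x e) := by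
    rw [Matrix.sum_mulVec, dotProduct_sum]
    exact Finset.sum_congr rfl fun e _ => by
      rw [Matrix.smul_mulVec, dotProduct_smul, hAquad, smul_eq_mul]
  have htail (s : Bool → ℝ) (hs : ∀ z, 0 ≤ z → z ≤ ε / 6 →
      1 / 4 * Real.exp (s true * z) + (1 - 1 / 4) * Real.exp (s false * z) ≤ 1) :
      ∑ ζ : Sym2 V → Bool with
          ∃ x, ε * B.energy x < ∑ e, s (ζ e) * (G.outsideWeight B e * sqDiff x e),
        ∏ e, coinWeight (1 / 4) (ζ e) ≤
      Fintype.card V * Real.exp (-(ε / 6 / (α / t) * ε)) := by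
    refine Matrix.sum_coinWeight_le_of_posSemidef s (by norm_num) (by norm_num) (by positivity)
      (by positivity) hs B.posSemidef_laplacian hA hAB ε fun ζ hζ => ?_
    obtain ⟨x, hx⟩ := (Finset.mem_filter.1 hζ).2
    exact ⟨x, by rwa [hsum, dotProduct_laplacian_mulVec]⟩
  -- This is the failure of `G ≤ (1 + ε) H`: a kept edge contributes `1 - 4 * (1 + ε)`, a dropped
  -- one `1`.
  have hlower := htail (fun b => if b = true then -(3 + 4 * ε) else 1)
    fun z hz hzε => by simpa using coin_mgf_lower_tail_le hε1 hz hzε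
  -- This is the failure of `(1 - ε) H ≤ G`: a kept edge contributes `4 * (1 - ε) - 1`, a dropped
  -- one `-1`.
  have hupper := htail (fun b => if b = true then 3 - 4 * ε else -1)
    fun z hz hzε => by simpa using coin_mgf_upper_tail_le hε1 hz hzε
  have hw (ζ : Sym2 V → Bool) : 0 ≤ ∏ e, coinWeight (1 / 4) (ζ e) :=
    Finset.prod_nonneg fun e _ => coinWeight_nonneg (by norm_num) (by norm_num) _
  refine le_trans ?_ ((add_le_add hlower hupper).trans (by linarith))
  rw [← Finset.sum_union_inter]
  refine le_add_of_le_of_nonneg (Finset.sum_le_sum_of_subset_of_nonneg ?_ fun ζ _ _ => hw ζ)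
    (Finset.sum_nonneg fun ζ _ => hw ζ)
  intro ζ hζ
  have hBG : ∀ e ∈ B.edgeSet, B.weight e = G.weight e := fun e he => h.weight_eq he
  have hζ' : ∃ x : V → ℝ, ¬ ((1 - ε) * (lightSpectralSparsify G B ζ).energy x ≤ G.energy x ∧
      G.energy x ≤ (1 + ε) * (lightSpectralSparsify G B ζ).energy x) := by
    by_contra! hcon
    refine (Finset.mem_filter.1 hζ).2 ⟨edgeSet_lightSpectralSparsify_subset hBG ζ, fun x => ?_⟩
    rw [dotProduct_laplacian_mulVec, dotProduct_laplacian_mulVec]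
    exact hcon x
  obtain ⟨x, hx⟩ := hζ'
  rw [not_and_or, not_le, not_le, energy_lightSpectralSparsify, energy_eq_add_outside hBG] at hx
  simp only [Finset.mem_union, Finset.mem_filter, Finset.mem_univ, true_and]
  set a : Sym2 V → ℝ := fun e => G.outsideWeight B e * sqDiff x e
  have hlin (p q : ℝ) : ∑ e, (if ζ e = true then 4 * p + q else q) * a e =
      p * ∑ e, (if ζ e = true then 4 else 0) * a e + q * ∑ e, a e := by
    rw [Finset.mul_sum, Finset.mul_sum, ← Finset.sum_add_distrib]
    refine Finset.sum_congr rfl fun e _ => ?_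
    split_ifs <;> ring
  obtain hx | hx := hx
  · refine Or.inr ⟨x, ?_⟩
    have := hlin (1 - ε) (-1)
    rw [show 4 * (1 - ε) + -1 = 3 - 4 * ε by ring] at this
    rw [this]
    linarith
  · refine Or.inl ⟨x, ?_⟩
    have := hlin (-(1 + ε)) 1
    rw [show 4 * -(1 + ε) + 1 = -(3 + 4 * ε) by ring] at this
    rw [this]
    linarith

/-! ### Measurability and averaging over the random input. -/

/-- For fixed coins, the success of Light-Spectral-Sparsify is a measurable event. -/
theorem measurableSet_isSpectralSparsifier_lightSpectralSparsify {Ω : Type*} {m : MeasurableSpace Ω}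
    {G B : Ω → WeightedGraph V} (hG : Measurable fun ω => (G ω).weight)
    (hB : Measurable fun ω => (B ω).weight) (ε : ℝ) (ζ : Sym2 V → Bool) :
    MeasurableSet {ω | IsSpectralSparsifier ε (lightSpectralSparsify (G ω) (B ω) ζ) (G ω)} := by
  have hGe (e : Sym2 V) : Measurable fun ω => (G ω).weight e := (measurable_pi_apply e).comp hG
  have hBe (e : Sym2 V) : Measurable fun ω => (B ω).weight e := (measurable_pi_apply e).comp hB
  have hHe (e : Sym2 V) :
      Measurable fun ω => (lightSpectralSparsify (G ω) (B ω) ζ).weight e := by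
    refine Measurable.ite (measurableSet_lt measurable_const (hBe e)) (hBe e) ?_
    split_ifs
    exacts [(hGe e).const_mul 4, measurable_const]
  have hH : Measurable fun ω => (lightSpectralSparsify (G ω) (B ω) ζ).weight :=
    measurable_pi_iff.2 hHe
  -- The condition ranges over uncountably many `x`, so measurability comes from closedness in the
  -- pair of weight functions, which passes to arbitrary intersections.
  have hclosed : IsClosed {p : (Sym2 V → ℝ) × (Sym2 V → ℝ) | ∀ x : V → ℝ,
      (1 - ε) * ∑ e, p.1 e * sqDiff x e ≤ ∑ e, p.2 e * sqDiff x e ∧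
      ∑ e, p.2 e * sqDiff x e ≤ (1 + ε) * ∑ e, p.1 e * sqDiff x e} := by
    simp only [Set.ofPred_forall, Set.ofPred_and]
    exact isClosed_iInter fun x => (isClosed_le (by fun_prop) (by fun_prop)).inter
      (isClosed_le (by fun_prop) (by fun_prop))
  have hedge : MeasurableSet {ω | ∀ e, 0 < (lightSpectralSparsify (G ω) (B ω) ζ).weight e →
      0 < (G ω).weight e} := by
    simp only [Set.ofPred_forall]
    refine MeasurableSet.iInter fun e => ?_
    have : {ω | 0 < (lightSpectralSparsify (G ω) (B ω) ζ).weight e → 0 < (G ω).weight e} =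
        {ω | 0 < (lightSpectralSparsify (G ω) (B ω) ζ).weight e}ᶜ ∪ {ω | 0 < (G ω).weight e} := by
      ext ω
      exact imp_iff_not_or
    rw [this]
    exact (measurableSet_lt measurable_const (hHe e)).compl.union
      (measurableSet_lt measurable_const (hGe e))
  convert hedge.inter (hclosed.measurableSet.preimage (hH.prodMk hG)) using 1
  ext ω
  simp only [IsSpectralSparsifier, dotProduct_laplacian_mulVec]
  rfl

end WeightedGraph

theorem measureReal_coins_eq {ι Ω : Type*} [Fintype ι] [MeasurableSpace Ω] {μ : Measure Ω}
    [IsProbabilityMeasure μ] {p : ℝ} {ξ : ι → Ω → Bool} (hξ : ∀ e, Measurable (ξ e))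
    (hcoin : ∀ e, μ.real {ω | ξ e ω = true} = p) (hindep : iIndepFun ξ μ) (ζ : ι → Bool) :
    μ.real ((fun ω e => ξ e ω) ⁻¹' {ζ}) = ∏ e, coinWeight p (ζ e) := by
  have hset : (fun ω e => ξ e ω) ⁻¹' {ζ} = ⋂ e ∈ Finset.univ, ξ e ⁻¹' {ζ e} := by
    ext ω
    simp [funext_iff]
  rw [hset, measureReal_def, hindep.measure_inter_preimage_eq_mul Finset.univ
    fun e _ => measurableSet_singleton _, ENNReal.toReal_prod]
  refine Finset.prod_congr rfl fun e _ => ?_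
  have htrue : ξ e ⁻¹' {true} = {ω | ξ e ω = true} := rfl
  have hfalse : ξ e ⁻¹' {false} = {ω | ξ e ω = true}ᶜ := by ext ω; simp
  have hmeas : MeasurableSet {ω | ξ e ω = true} := hξ e (measurableSet_singleton true)
  cases hb : ζ e with
  | true => rw [htrue]; exact hcoin e
  | false =>
    rw [hfalse, ← measureReal_def, probReal_compl_eq_one_sub hmeas, hcoin e]
    simp [coinWeight]

theorem mainTheorem10 {V : Type*} [Fintype V]
    {Ω : Type*} [MeasurableSpace Ω] (μ : Measure Ω) [IsProbabilityMeasure μ]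
    (c α ε : ℝ) (hc : 1 ≤ c) (hα : 1 ≤ α) (hε : 0 < ε) (hε1 : ε ≤ 1)
    -- the (possibly random) input graph, and the bundle that the algorithm picks for it
    (G B : Ω → WeightedGraph V)
    (hG : Measurable fun ω => (G ω).weight) (hB : Measurable fun ω => (B ω).weight)
    (hbundle : ∀ᵐ ω ∂μ,
      WeightedGraph.IsBundleSpanner (lightBundleSize c α ε (Fintype.card V)) α (B ω) (G ω))
    -- the independent coins of the algorithm, each of which shows `true` with probability `1/4`
    (ξ : Sym2 V → Ω → Bool) (hξ : ∀ e, Measurable (ξ e))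
    (hcoin : ∀ e, μ.real {ω | ξ e ω = true} = 1 / 4)
    (hindep : iIndepFun ξ μ)
    -- the coins are independent of the input graph and the bundle
    (hinput : IndepFun (fun ω => ((G ω).weight, (B ω).weight)) (fun ω e => ξ e ω) μ) :
    1 - (Fintype.card V : ℝ) ^ (-(c + 1)) ≤
      μ.real {ω | WeightedGraph.IsSpectralSparsifier ε
        (lightSpectralSparsify (G ω) (B ω) fun e => ξ e ω) (G ω)} := by
  classical
  obtain hn | hn := lt_or_ge (Fintype.card V) 2
  -- For `n = 0` the sparsifier property is vacuous, and for `n = 1` the claimed lower bound is `0`.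
  · have hn' : Fintype.card V = 0 ∨ Fintype.card V = 1 := by omega
    obtain hn0 | hn1 := hn'
    · have hV : IsEmpty V := Fintype.card_eq_zero_iff.1 hn0
      have huniv : {ω | WeightedGraph.IsSpectralSparsifier ε
          (lightSpectralSparsify (G ω) (B ω) fun e => ξ e ω) (G ω)} = Set.univ := by
        refine Set.eq_univ_of_forall fun ω => ⟨fun e => isEmptyElim e, fun x => ?_⟩
        simp [dotProduct]
      rw [huniv, probReal_univ]
      exact sub_le_self _ (by positivity)
    · rw [hn1, Nat.cast_one, Real.one_rpow, sub_self]
      exact measureReal_nonneg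
  set bad : (Sym2 V → Bool) → Set Ω := fun ζ =>
    {ω | ¬ WeightedGraph.IsSpectralSparsifier ε (lightSpectralSparsify (G ω) (B ω) ζ) (G ω)}
  set input : Ω → (Sym2 V → ℝ) × (Sym2 V → ℝ) := fun ω => ((G ω).weight, (B ω).weight)
  have hinputm : Measurable input := hG.prodMk hB
  -- With the coins frozen at `ζ`, failure depends on the input alone, so it is independent of the
  -- event that the coins show `ζ`.
  have hbad_comap (ζ : Sym2 V → Bool) :
      MeasurableSet[MeasurableSpace.comap input inferInstance] (bad ζ) := by
    refine MeasurableSet.compl ?_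
    have hm : Measurable[MeasurableSpace.comap input inferInstance] input :=
      comap_measurable input
    exact WeightedGraph.measurableSet_isSpectralSparsifier_lightSpectralSparsify
      (m := MeasurableSpace.comap input inferInstance)
      (measurable_fst.comp hm) (measurable_snd.comp hm) ε ζ
  have hbad (ζ : Sym2 V → Bool) : MeasurableSet (bad ζ) :=
    hinputm.comap_le _ (hbad_comap ζ)
  have hfiber (ζ : Sym2 V → Bool) : μ.real (bad ζ ∩ (fun ω e => ξ e ω) ⁻¹' {ζ}) =
      μ.real (bad ζ) * ∏ e, coinWeight (1 / 4) (ζ e) := by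
    rw [← measureReal_coins_eq hξ hcoin hindep ζ, measureReal_def, measureReal_def,
      measureReal_def, ← ENNReal.toReal_mul]
    congr 1
    exact (IndepFun_iff _ _ _).1 hinput _ _ (hbad_comap ζ)
      ⟨{ζ}, measurableSet_singleton ζ, rfl⟩
  have hunion : {ω | WeightedGraph.IsSpectralSparsifier ε
      (lightSpectralSparsify (G ω) (B ω) fun e => ξ e ω) (G ω)}ᶜ =
      ⋃ ζ, bad ζ ∩ (fun ω e => ξ e ω) ⁻¹' {ζ} := by
    ext ω
    simp [bad]
  have hgood : MeasurableSet {ω | WeightedGraph.IsSpectralSparsifier ε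
      (lightSpectralSparsify (G ω) (B ω) fun e => ξ e ω) (G ω)} := by
    rw [← MeasurableSet.compl_iff, hunion]
    exact MeasurableSet.iUnion fun ζ => (hbad ζ).inter
      (measurable_pi_iff.2 hξ (measurableSet_singleton ζ))
  have hfail : μ.real {ω | WeightedGraph.IsSpectralSparsifier ε
      (lightSpectralSparsify (G ω) (B ω) fun e => ξ e ω) (G ω)}ᶜ ≤
      (Fintype.card V : ℝ) ^ (-(c + 1)) := by
    calc _ ≤ ∑ ζ, μ.real (bad ζ ∩ (fun ω e => ξ e ω) ⁻¹' {ζ}) := by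
          rw [hunion]
          exact measureReal_iUnion_fintype_le _
      -- Writing each product as an integral and exchanging sum and integral reduces the estimate to
      -- the bound for fixed `G ω` and `B ω`, which holds for almost every `ω`.
      _ = ∑ ζ, ∫ ω, (bad ζ).indicator (fun _ => ∏ e, coinWeight (1 / 4) (ζ e)) ω ∂μ := by
          refine Finset.sum_congr rfl fun ζ _ => ?_
          rw [hfiber, integral_indicator_const _ (hbad ζ), smul_eq_mul]
      _ = ∫ ω, ∑ ζ, (bad ζ).indicator (fun _ => ∏ e, coinWeight (1 / 4) (ζ e)) ω ∂μ :=
          (integral_finsetSum _ fun ζ _ => (integrable_const _).indicator (hbad ζ)).symm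
      _ ≤ ∫ _, (Fintype.card V : ℝ) ^ (-(c + 1)) ∂μ := by
          refine integral_mono_ae (integrable_finsetSum _ fun ζ _ =>
            (integrable_const _).indicator (hbad ζ)) (integrable_const _) ?_
          filter_upwards [hbundle] with ω hω
          have := WeightedGraph.sum_coinWeight_not_isSpectralSparsifier_le hc hα hε hε1 hn hω
          rw [Finset.sum_filter] at this
          refine le_of_eq_of_le (Finset.sum_congr rfl fun ζ _ => ?_) this
          by_cases hζ : ω ∈ bad ζ
          · exact (Set.indicator_of_mem hζ _).trans (if_pos hζ).symm
          · exact (Set.indicator_of_notMem hζ _).trans (if_neg hζ).symm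
      _ = (Fintype.card V : ℝ) ^ (-(c + 1)) := by simp
  rw [probReal_compl_eq_one_sub hgood] at hfail
  linarith
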